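/- For complex $\lambda$ let $G_j^{\lambda}$ ($j=0,1,2,\dots$) be the Gegenbauer polynomials, defined by $G_0^\lambda(\xi)=1$, $G_1^\lambda(\xi)=2\lambda\xi$ and $$(j+2)\,G_{j+2}^{\lambda}(\xi)=2(j+1+\lambda)\,\xi\,G_{j+1}^{\lambda}(\xi)-(j+2\lambda)\,G_j^{\lambda}(\xi)\qquad(j\ge 0);$$ these are the coefficients in the generating function $(1+2u\xi+u^2)^{-\lambda}=\sum_{j\ge 0}(-u)^jG_j^\lambda(\xi)$, valid for $-1<\xi<1$ and small $|u|$. For complex $\mu,\nu$ and $-1<\xi<1$ let $$P_\nu^\mu(\xi)=\frac{1}{\Gamma(1-\mu)}\left(\frac{1+\xi}{1-\xi}\right)^{\mu/2}{}_2F_1\!\left(-\nu,\nu+1;1-\mu;\frac{1-\xi}{2}\right)$$ be the associated Legendre function of the first kind on the cut, where ${}_2F_1(\cdot,\cdot;1-\mu;\cdot)/\Gamma(1-\mu)$ is understood as the regularized hypergeometric function if $1-\mu$ is a non-positive integer. All powers of positive real numbers are principal values. **Proposition.** Let $q\ge 0$ be an integer, let $\xi$ be real with $-1<\xi<1$, and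 let $\lambda$ and $s$ be complex numbers with $\operatorname{Re}\lambda>0$ and $-q-1<\operatorname{Re}s<-q$. Put $$h(u)=-\left(1+2u\xi+u^2\right)^{-\lambda}+\sum_{j=0}^{q}(-u)^jG_j^{\lambda}(\xi),\qquad u>0.$$ Then the Mellin integral $\int_0^\infty h(u)\,u^{s-1}\,du$ converges absolutely and $$\int_0^\infty h(u)\,u^{s-1}\,du=-\frac{\sqrt{\pi}\,\Gamma(s)\,\Gamma(2\lambda-s)}{2^{\lambda-1/2}\,\Gamma(\lambda)}\,(1-\xi^2)^{\frac{1-2\lambda}{4}}\,P^{1/2-\lambda}_{s-\lambda-1/2}(\xi).$$ -/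

import Mathlib

/-- The Gegenbauer (ultraspherical) polynomial `G_j^λ` with complex parameter `λ`, given by
`G_0 = 1`, `G_1 = 2 λ X` and the three-term recurrence
`(j + 2) G_{j+2} = 2 (j + 1 + λ) X G_{j+1} - (j + 2 λ) G_j`. These are the coefficients in
`(1 - 2 t x + t ^ 2) ^ (-λ) = ∑ t ^ j G_j^λ(x)`. -/
noncomputable def gegenbauer (lam : ℂ) : ℕ → Polynomial ℂ
  | 0 => 1
  | 1 => Polynomial.C (2 * lam) * Polynomial.X
  | j + 2 =>
      Polynomial.C ((j + 2 : ℂ)⁻¹) *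
        (Polynomial.C (2 * ((j : ℂ) + 1 + lam)) * Polynomial.X * gegenbauer lam (j + 1)
          - Polynomial.C ((j : ℂ) + 2 * lam) * gegenbauer lam j)

/-- The associated Legendre function of the first kind on the cut `-1 < x < 1`, of degree `ν` and
order `μ`:
`P_ν^μ(x) = ((1 + x) / (1 - x)) ^ (μ / 2) * ₂F₁(-ν, ν + 1; 1 - μ; (1 - x) / 2) / Γ(1 - μ)`.
The quotient `₂F₁ / Γ(1 - μ)` is the regularized Gauss hypergeometric function, which is entire
in the parameters. -/
noncomputable def legendreOnCut (ν μ : ℂ) (x : ℝ) : ℂ :=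
  (((1 + x) / (1 - x) : ℝ) : ℂ) ^ (μ / 2) *
    Complex.regularizedGaussHGFun (-ν) (ν + 1) (1 - μ) (((1 - x) / 2 : ℝ) : ℂ)

/-- The Riesz kernel `k_λ(u, ξ) = (1 + 2 u ξ + u ^ 2) ^ (-λ)`. -/
noncomputable def rieszKernel (lam : ℂ) (ξ u : ℝ) : ℂ :=
  ((1 + 2 * u * ξ + u ^ 2 : ℝ) : ℂ) ^ (-lam)

/-- The modified kernel
`h(λ, q, u, ξ) = -k_λ(u, ξ) + ∑_{j = 0}^q (-u) ^ j G_j^λ(ξ)`. -/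
noncomputable def modifiedKernel (lam : ℂ) (q : ℕ) (ξ u : ℝ) : ℂ :=
  -rieszKernel lam ξ u
    + ∑ j ∈ Finset.range (q + 1), (-(u : ℂ)) ^ j * (gegenbauer lam j).eval (ξ : ℂ)

/-!
With `x = (1 - ξ) / 2` one has `1 + 2uξ + u² = (1 + u)² (1 - 4xu / (1 + u)²)`, and
`0 ≤ 4xu / (1 + u)² ≤ x < 1` for `u > 0`. The binomial series therefore expands the kernel as
`∑ cₙ uⁿ (1 + u) ^ (-2λ - 2n)` with `cₙ = (λ)ₙ (4x)ⁿ / n!` (`hasSum_rieszKernel`). Each term has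
the beta integral `Γ(s + n) Γ(2λ - s + n) / Γ(2λ + 2n)` as its Mellin transform.

The Gegenbauer sum in the modified kernel is the Taylor polynomial of the kernel at `u = 0`. It is
also the sum of the Taylor polynomials of the terms (`sum_gegenbauer_eq`), because the expansion of
`G_j` in powers of `ξ - 1`, read off from the terms, satisfies the recurrence that defines `G_j`
(`eval_gegenbauer_eq_sum`). So the modified kernel is, up to sign, the sum of the Taylor remainders
of the terms, and all but the first `q + 1` of these remainders are the terms themselves. Passing
from `(1 + u) ^ (-β)` to its `m`-th Taylor remainder moves the strip of convergence from
`0 < Re s < Re β` to `-m < Re s < 1 - m` and keeps the formula `Γ(s) Γ(β - s) / Γ(β)`, by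
integration by parts (`hasMellin_binomialRemainder`). The series may be integrated termwise, since
`4u / (1 + u)² ≤ 1` bounds its tail by a convergent series of numbers times one integrable function
(`summable_integral_norm_modifiedKernel_terms`).

Legendre's duplication formula turns the resulting sum into the hypergeometric series with
parameters `s, 2λ - s, λ + 1/2` at `x` (`risingCoeff_mul_Gamma_mul_Gamma_div`). Euler's
transformation (`regularizedGaussHGFun_eq_cpow_mul`) turns that into the Legendre function. It is
proved for formal power series (`mk_gaussCoeff_eq_mul`): multiplication by `(1 - X) ^ (c - a - b)`
carries one hypergeometric differential equation into the other, and such an equation determines a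
power series from its constant term.
-/

open Complex MeasureTheory Set Filter Topology
open scoped Nat

/-! ### The binomial series -/

/-- The coefficient `(a)_n / n!` of `z ^ n` in the binomial series of `(1 - z) ^ (-a)`. -/
noncomputable def risingCoeff (a : ℂ) (n : ℕ) : ℂ :=
  (ascPochhammer ℂ n).eval a / n !

@[simp] lemma risingCoeff_zero (a : ℂ) : risingCoeff a 0 = 1 := by
  simp [risingCoeff]

lemma succ_mul_risingCoeff_succ (a : ℂ) (n : ℕ) :
    ((n : ℂ) + 1) * risingCoeff a (n + 1) = (a + n) * risingCoeff a n := by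
  have h1 : ((n : ℂ) + 1) ≠ 0 := Nat.cast_add_one_ne_zero n
  have h2 : ((n ! : ℕ) : ℂ) ≠ 0 := Nat.cast_ne_zero.mpr n.factorial_ne_zero
  simp only [risingCoeff, ascPochhammer_succ_eval, Nat.factorial_succ, Nat.cast_mul, Nat.cast_succ]
  field_simp

lemma succ_mul_risingCoeff_succ' (a : ℂ) (n : ℕ) :
    ((n : ℂ) + 1) * risingCoeff a (n + 1) = a * risingCoeff (a + 1) n := by
  have h1 : ((n : ℂ) + 1) ≠ 0 := Nat.cast_add_one_ne_zero n
  have h2 : ((n ! : ℕ) : ℂ) ≠ 0 := Nat.cast_ne_zero.mpr n.factorial_ne_zero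
  simp only [risingCoeff, ascPochhammer_succ_left, Nat.factorial_succ, Nat.cast_mul, Nat.cast_succ,
    Polynomial.eval_mul, Polynomial.eval_X, Polynomial.eval_comp, Polynomial.eval_add,
    Polynomial.eval_one]
  field_simp

lemma hasFPowerSeriesOnBall_risingCoeff (a : ℂ) :
    HasFPowerSeriesOnBall (fun z : ℂ ↦ (1 - z) ^ (-a))
      (FormalMultilinearSeries.ofScalars ℂ (risingCoeff a)) 0 1 := by
  have hfun : (fun z : ℂ ↦ (1 - z) ^ (-a)) = fun z ↦ 1 / (1 - z) ^ a := by
    ext z; rw [cpow_neg, one_div]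
  have hcoeff : risingCoeff a = fun n : ℕ ↦ Ring.choose (a + n - 1) n := by
    ext n
    have h2 : ((n ! : ℕ) : ℂ) ≠ 0 := Nat.cast_ne_zero.mpr n.factorial_ne_zero
    have h := Ring.factorial_nsmul_multichoose_eq_ascPochhammer a n
    rw [Polynomial.ascPochhammer_smeval_eq_eval, nsmul_eq_mul] at h
    rw [risingCoeff, ← h, mul_div_cancel_left₀ _ h2]
    exact Ring.multichoose_eq a n
  rw [hfun, hcoeff]
  exact one_div_one_sub_cpow_hasFPowerSeriesOnBall_zero a

lemma summable_norm_risingCoeff_mul_pow (a : ℂ) {z : ℂ} (hz : ‖z‖ < 1) :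
    Summable fun n ↦ ‖risingCoeff a n * z ^ n‖ := by
  have := (hasFPowerSeriesOnBall_risingCoeff a).r_le
  have h := FormalMultilinearSeries.summable_norm_apply
    (FormalMultilinearSeries.ofScalars ℂ (risingCoeff a)) (x := z)
    (Metric.eball_subset_eball this (by simpa [enorm_eq_nnnorm] using! hz))
  simpa [FormalMultilinearSeries.ofScalars_apply_eq, mul_comm] using h

/-- The binomial series, `∑ (a)_n / n! z ^ n = (1 - z) ^ (-a)`. -/
lemma hasSum_risingCoeff_mul_pow (a : ℂ) {z : ℂ} (hz : ‖z‖ < 1) :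
    HasSum (fun n ↦ risingCoeff a n * z ^ n) ((1 - z) ^ (-a)) := by
  have h := (hasFPowerSeriesOnBall_risingCoeff a).hasSum (y := z)
    (by simpa [enorm_eq_nnnorm] using! hz)
  simpa [FormalMultilinearSeries.ofScalars_apply_eq, mul_comm] using h

/-! ### Taylor remainders of `(1 + u) ^ (-β)` and their Mellin transforms -/

/-- The remainder of `(1 + u) ^ (-β)` after the first `m` terms of its Taylor series at `0`. -/
noncomputable def binomialRemainder (β : ℂ) (m : ℕ) (u : ℝ) : ℂ :=
  (1 + (u : ℂ)) ^ (-β) - ∑ j ∈ Finset.range m, risingCoeff β j * (-(u : ℂ)) ^ j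

lemma one_add_ofReal_mem_slitPlane {u : ℝ} (hu : 0 ≤ u) : 1 + (u : ℂ) ∈ slitPlane := by
  rw [mem_slitPlane_iff]; left; simp; linarith

lemma binomialRemainder_succ (β : ℂ) (m : ℕ) (u : ℝ) :
    binomialRemainder β (m + 1) u
      = binomialRemainder β m u - risingCoeff β m * (-(u : ℂ)) ^ m := by
  rw [binomialRemainder, binomialRemainder, Finset.sum_range_succ]; ring

lemma hasDerivAt_binomialRemainder_succ (β : ℂ) (m : ℕ) {u : ℝ} (hu : 0 ≤ u) :
    HasDerivAt (binomialRemainder β (m + 1)) (-β * binomialRemainder (β + 1) m u) u := by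
  have h1 : HasDerivAt (fun z : ℂ ↦ (1 + z) ^ (-β)) (-β * (1 + (u : ℂ)) ^ (-β - 1)) u := by
    simpa using ((hasDerivAt_id (u : ℂ)).const_add 1).cpow_const (c := -β)
      (one_add_ofReal_mem_slitPlane hu)
  have h2 : HasDerivAt (fun z : ℂ ↦ ∑ j ∈ Finset.range (m + 1), risingCoeff β j * (-z) ^ j)
      (-β * ∑ j ∈ Finset.range m, risingCoeff (β + 1) j * (-(u : ℂ)) ^ j) u := by
    have hsum : (fun z : ℂ ↦ ∑ j ∈ Finset.range (m + 1), risingCoeff β j * (-z) ^ j) =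
        fun z ↦ ∑ j ∈ Finset.range m, risingCoeff β (j + 1) * (-z) ^ (j + 1) + 1 := by
      ext z; simp [Finset.sum_range_succ']
    rw [hsum]
    refine HasDerivAt.add_const _ ?_
    rw [Finset.mul_sum]
    refine HasDerivAt.fun_sum fun j _ ↦ ?_
    refine (((hasDerivAt_id (u : ℂ)).neg.pow (j + 1)).const_mul
      (risingCoeff β (j + 1))).congr_deriv ?_
    have := succ_mul_risingCoeff_succ' β j
    simp only [Nat.add_sub_cancel, Pi.neg_apply, id, Nat.cast_add, Nat.cast_one]
    linear_combination (-(-(u : ℂ)) ^ j) * this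
  have h := (h1.sub h2).comp_ofReal
  refine HasDerivAt.congr_deriv (f := binomialRemainder β (m + 1)) h ?_
  simp only [binomialRemainder, neg_add']
  ring

lemma binomialRemainder_succ_zero (β : ℂ) (m : ℕ) : binomialRemainder β (m + 1) 0 = 0 := by
  simp [binomialRemainder, Finset.sum_range_succ']

lemma continuousOn_binomialRemainder (β : ℂ) (m : ℕ) :
    ContinuousOn (binomialRemainder β m) (Ici 0) := by
  refine ContinuousOn.sub (ContinuousOn.cpow_const (by fun_prop) ?_) (by fun_prop)
  exact fun u hu ↦ one_add_ofReal_mem_slitPlane hu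

/-- The bound that governs the remainder near `0`. -/
lemma exists_norm_binomialRemainder_le (m : ℕ) {β : ℂ} (hβ : 0 ≤ β.re) :
    ∃ C, 0 ≤ C ∧ ∀ u : ℝ, 0 ≤ u → ‖binomialRemainder β m u‖ ≤ C * u ^ m := by
  induction m generalizing β with
  | zero =>
    refine ⟨1, zero_le_one, fun u hu ↦ ?_⟩
    have : 1 + (u : ℂ) = ((1 + u : ℝ) : ℂ) := by push_cast; rfl
    simp only [binomialRemainder, Finset.range_zero, Finset.sum_empty, sub_zero, pow_zero, mul_one]
    rw [this, norm_cpow_eq_rpow_re_of_pos (by linarith), neg_re]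
    exact Real.rpow_le_one_of_one_le_of_nonpos (by linarith) (by linarith)
  | succ m ih =>
    obtain ⟨C, hC, h⟩ := ih (β := β + 1) (by simp; linarith)
    refine ⟨‖β‖ * C, by positivity, fun u hu ↦ ?_⟩
    have := Convex.norm_image_sub_le_of_norm_hasDerivWithin_le
      (f := binomialRemainder β (m + 1)) (f' := fun x ↦ -β * binomialRemainder (β + 1) m x)
      (s := Icc 0 u) (C := ‖β‖ * (C * u ^ m)) (x := 0) (y := u)
      (fun x hx ↦ (hasDerivAt_binomialRemainder_succ β m hx.1).hasDerivWithinAt)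
      (fun x hx ↦ ?_) (convex_Icc 0 u) ⟨le_rfl, hu⟩ ⟨hu, le_rfl⟩
    · rw [binomialRemainder_succ_zero, sub_zero, sub_zero, Real.norm_of_nonneg hu] at this
      exact this.trans_eq (by ring)
    · rw [norm_mul, norm_neg]
      have hx0 := hx.1
      have hx1 := hx.2
      refine mul_le_mul_of_nonneg_left ((h x hx.1).trans ?_) (norm_nonneg _)
      gcongr

/-- The bound that governs the remainder near infinity, where the last Taylor term dominates. -/
lemma exists_norm_binomialRemainder_succ_le (m : ℕ) {β : ℂ} (hβ : 0 ≤ β.re) :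
    ∃ C, 0 ≤ C ∧ ∀ u : ℝ, 0 ≤ u → ‖binomialRemainder β (m + 1) u‖ ≤ C * u ^ m := by
  obtain ⟨C, hC, h⟩ := exists_norm_binomialRemainder_le m hβ
  refine ⟨C + ‖risingCoeff β m‖, by positivity, fun u hu ↦ ?_⟩
  rw [binomialRemainder_succ, add_mul]
  refine (norm_sub_le _ _).trans (add_le_add (h u hu) ?_)
  rw [norm_mul, norm_pow, norm_neg, norm_real, Real.norm_of_nonneg hu]

lemma mellinConvergent_binomialRemainder_succ (m : ℕ) {β s : ℂ} (hβ : 0 ≤ β.re)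
    (h1 : -(m : ℝ) - 1 < s.re) (h2 : s.re < -(m : ℝ)) :
    MellinConvergent (binomialRemainder β (m + 1)) s := by
  obtain ⟨C, -, hC⟩ := exists_norm_binomialRemainder_le (m + 1) hβ
  obtain ⟨D, -, hD⟩ := exists_norm_binomialRemainder_succ_le m hβ
  refine mellinConvergent_of_isBigO_rpow (a := -m) (b := -m - 1)
    (((continuousOn_binomialRemainder β _).mono Ioi_subset_Ici_self).locallyIntegrableOn
      measurableSet_Ioi) ?_ h2 ?_ h1
  · refine Asymptotics.IsBigO.of_bound D ?_
    filter_upwards [eventually_gt_atTop 0] with u hu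
    simpa [abs_of_pos hu] using hD u hu.le
  · refine Asymptotics.IsBigO.of_bound C ?_
    filter_upwards [self_mem_nhdsWithin] with u hu
    have hu : 0 < u := hu
    have : -(-(m : ℝ) - 1) = ((m + 1 : ℕ) : ℝ) := by push_cast; ring
    rw [this, Real.rpow_natCast, Real.norm_of_nonneg (by positivity)]
    exact hC u hu.le

lemma image_div_one_add_Ioi : (fun u : ℝ ↦ u / (1 + u)) '' Ioi 0 = Ioo 0 1 := by
  ext x
  constructor
  · rintro ⟨u, hu, rfl⟩
    have hu : 0 < u := hu
    exact ⟨by positivity, (div_lt_one (by positivity)).mpr (by linarith)⟩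
  · rintro ⟨h0, h1⟩
    have : 0 < 1 - x := by linarith
    refine ⟨x / (1 - x), div_pos h0 this, ?_⟩
    field_simp
    ring

/-- The Mellin transform of `(1 + u) ^ (-β)` is a beta integral, by the substitution
`x = u / (1 + u)`. -/
lemma hasMellin_one_add_cpow {β s : ℂ} (h1 : 0 < s.re) (h2 : s.re < β.re) :
    HasMellin (fun u : ℝ ↦ (1 + (u : ℂ)) ^ (-β)) s (Gamma s * Gamma (β - s) / Gamma β) := by
  have hderiv : ∀ u ∈ Ioi (0 : ℝ),
      HasDerivWithinAt (fun u : ℝ ↦ u / (1 + u)) (1 / (1 + u) ^ 2) (Ioi 0) u := by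
    intro u hu
    have hu : 0 < u := hu
    have := (hasDerivAt_id u).div ((hasDerivAt_id u).const_add 1) (by simp; positivity)
    exact (this.congr_deriv (by simp)).hasDerivWithinAt
  have hinj : InjOn (fun u : ℝ ↦ u / (1 + u)) (Ioi 0) := by
    intro u hu v hv h
    have hu : 0 < u := hu
    have hv : 0 < v := hv
    have : 0 < 1 + u := by linarith
    have : 0 < 1 + v := by linarith
    simp only at h
    field_simp at h
    linarith
  set g : ℝ → ℂ := fun x ↦ (x : ℂ) ^ (s - 1) * (1 - (x : ℂ)) ^ (β - s - 1) with hg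
  have hcongr : EqOn (fun u : ℝ ↦ |1 / (1 + u) ^ 2| • g (u / (1 + u)))
      (fun u : ℝ ↦ (u : ℂ) ^ (s - 1) • (1 + (u : ℂ)) ^ (-β)) (Ioi 0) := by
    intro u hu
    have hu : 0 < u := hu
    have h1u : 0 < 1 + u := by linarith
    have hne : ((1 + u : ℝ) : ℂ) ≠ 0 := ofReal_ne_zero.mpr h1u.ne'
    have e1 : 1 - ((u / (1 + u) : ℝ) : ℂ) = (((1 + u)⁻¹ : ℝ) : ℂ) := by
      rw [← ofReal_one, ← ofReal_sub]
      congr 1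
      field_simp
      ring
    have e2 : (1 : ℂ) + u = ((1 + u : ℝ) : ℂ) := by push_cast; rfl
    simp only [hg, smul_eq_mul]
    rw [e1, e2, div_eq_mul_inv u, ofReal_mul,
      mul_cpow_ofReal_nonneg hu.le (by positivity), ofReal_inv,
      inv_cpow _ _ (by rw [arg_ofReal_of_nonneg h1u.le]; exact Real.pi_pos.ne),
      inv_cpow _ _ (by rw [arg_ofReal_of_nonneg h1u.le]; exact Real.pi_pos.ne),
      ← cpow_neg, ← cpow_neg, abs_of_pos (by positivity), real_smul]
    have e3 : ((1 / (1 + u) ^ 2 : ℝ) : ℂ) = ((1 + u : ℝ) : ℂ) ^ (-2 : ℂ) := by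
      rw [cpow_neg]; norm_cast; simp
    rw [e3]
    have : -β = -2 + (-(s - 1)) + (-(β - s - 1)) := by ring
    rw [this, cpow_add _ _ hne, cpow_add _ _ hne]
    ring
  have hint : IntegrableOn g (Ioo 0 1) := by
    have := betaIntegral_convergent h1 (v := β - s) (by simpa using h2)
    rw [intervalIntegrable_iff_integrableOn_Ioo_of_le zero_le_one] at this
    exact this
  have hval : ∫ x in Ioo 0 1, g x = Gamma s * Gamma (β - s) / Gamma β := by
    have hβ : Gamma β ≠ 0 := Gamma_ne_zero_of_re_pos (h1.trans h2)
    rw [Gamma_mul_Gamma_eq_betaIntegral h1 (by simpa using h2), add_sub_cancel,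
      mul_div_cancel_left₀ _ hβ, betaIntegral, intervalIntegral.integral_of_le zero_le_one,
      integral_Ioc_eq_integral_Ioo]
  rw [← image_div_one_add_Ioi] at hint hval
  constructor
  · exact (((integrableOn_image_iff_integrableOn_abs_deriv_smul measurableSet_Ioi hderiv hinj
      g).mp hint).congr_fun hcongr measurableSet_Ioi)
  · rw [← hval, integral_image_eq_integral_abs_deriv_smul measurableSet_Ioi hderiv hinj]
    exact (setIntegral_congr_fun measurableSet_Ioi hcongr).symm

/-- Integration by parts against `u ^ (s - 1)`, with boundary terms that vanish by the growth
bounds at the two ends. -/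
lemma hasMellin_of_hasDerivAt {f f' : ℝ → ℂ} {s a : ℂ} {p r : ℝ} (hs : s ≠ 0)
    (hf : ∀ u ∈ Ioi (0 : ℝ), HasDerivAt f (f' u) u) (hconv : MellinConvergent f s)
    (hf' : HasMellin f' (s + 1) a)
    (hbot : f =O[𝓝[>] 0] fun u : ℝ ↦ u ^ p) (hp : 0 < p + s.re)
    (htop : f =O[atTop] fun u : ℝ ↦ u ^ r) (hr : r + s.re < 0) :
    HasMellin f s (-a / s) := by
  refine ⟨hconv, ?_⟩
  have hv : ∀ u ∈ Ioi (0 : ℝ), HasDerivAt (fun u : ℝ ↦ (u : ℂ) ^ s / s) ((u : ℂ) ^ (s - 1)) u := by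
    intro u hu
    have := hasDerivAt_ofReal_cpow_const' (ne_of_gt hu : u ≠ 0) (r := s - 1)
      (by intro h; exact hs (by linear_combination h))
    simpa using this
  have hnorm : ∀ (l : Filter ℝ) (t : ℝ), (∀ᶠ u in l, 0 < u) → f =O[l] (fun u : ℝ ↦ u ^ t) →
      Tendsto (fun u : ℝ ↦ u ^ (t + s.re)) l (𝓝 0) →
      Tendsto (f * fun u : ℝ ↦ (u : ℂ) ^ s / s) l (𝓝 0) := by
    intro l t hl hO ht
    refine Asymptotics.IsBigO.trans_tendsto ?_ ht
    have h2 : (fun u : ℝ ↦ (u : ℂ) ^ s / s) =O[l] fun u : ℝ ↦ u ^ s.re := by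
      refine Asymptotics.IsBigO.of_bound ‖s‖⁻¹ ?_
      filter_upwards [hl] with u hu
      rw [norm_div, norm_cpow_eq_rpow_re_of_pos hu, Real.norm_of_nonneg (by positivity),
        div_eq_inv_mul]
    refine (hO.mul h2).congr' (EventuallyEq.refl _ _) ?_
    filter_upwards [hl] with u hu
    rw [Real.rpow_add hu]
  have h0 := hnorm (𝓝[>] 0) p self_mem_nhdsWithin hbot (by
    have : Tendsto (fun u : ℝ ↦ u ^ (p + s.re)) (𝓝 0) (𝓝 0) := by
      simpa [Real.zero_rpow hp.ne'] using (Real.continuousAt_rpow_const 0 (p + s.re)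
        (Or.inr hp.le)).tendsto
    exact this.mono_left nhdsWithin_le_nhds)
  have htop' := hnorm atTop r (eventually_gt_atTop 0) htop (by
    simpa using tendsto_rpow_neg_atTop (y := -(r + s.re)) (by linarith))
  have key := integral_Ioi_mul_deriv_eq_deriv_mul hf hv
    (by
      refine hconv.congr_fun (fun u _ ↦ ?_) measurableSet_Ioi
      simp [mul_comm])
    (by
      refine (hf'.1.div_const s).congr_fun (fun u _ ↦ ?_) measurableSet_Ioi
      simp only [add_sub_cancel_right, Pi.mul_apply, smul_eq_mul]
      ring) h0 htop'
  have e1 : mellin f s = ∫ x : ℝ in Ioi 0, f x * (x : ℂ) ^ (s - 1) := by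
    rw [mellin]; simp only [smul_eq_mul, mul_comm]
  rw [e1, key, ← hf'.2, mellin, sub_zero, zero_sub, neg_div, ← integral_div]
  congr 2
  ext u
  simp only [add_sub_cancel_right, smul_eq_mul]
  ring

/-- Removing Taylor polynomials moves the strip of convergence of the Mellin transform to the left
and leaves the transform unchanged as a meromorphic function. -/
lemma hasMellin_binomialRemainder (m : ℕ) {β s : ℂ} (hβ : 0 < β.re) (h1 : -(m : ℝ) < s.re)
    (h2 : s.re < β.re) (h3 : 0 < m → s.re < 1 - m) :
    HasMellin (binomialRemainder β m) s (Gamma s * Gamma (β - s) / Gamma β) := by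
  induction m generalizing β s with
  | zero =>
    have := hasMellin_one_add_cpow (β := β) (s := s) (by simpa using h1) h2
    convert this using 1
    ext u; simp [binomialRemainder]
  | succ m ih =>
    have h3' : s.re < -(m : ℝ) := by have := h3 (Nat.succ_pos m); push_cast at this; linarith
    have h1' : -(m : ℝ) - 1 < s.re := by push_cast at h1; linarith
    have hm : (0 : ℝ) ≤ m := Nat.cast_nonneg m
    have hs : s ≠ 0 := by rintro rfl; simp at h3'; linarith
    have hβ0 : β ≠ 0 := by rintro rfl; simp at hβ
    have hΓ : Gamma β ≠ 0 := Gamma_ne_zero_of_re_pos hβ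
    obtain ⟨C, -, hC⟩ := exists_norm_binomialRemainder_le (m + 1) hβ.le
    obtain ⟨D, -, hD⟩ := exists_norm_binomialRemainder_succ_le m hβ.le
    have ih' := ih (β := β + 1) (s := s + 1) (by simp; linarith) (by simp; linarith)
      (by simpa using h2) (by intro _; simp; linarith)
    have key := hasMellin_of_hasDerivAt (f := binomialRemainder β (m + 1)) (s := s)
      (p := m + 1) (r := m) hs
      (fun u hu ↦ hasDerivAt_binomialRemainder_succ β m (le_of_lt hu))
      (mellinConvergent_binomialRemainder_succ m hβ.le h1' h3')
      (hasMellin_const_smul ih'.1 (-β)) ?_ (by linarith) ?_ (by linarith)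
    · convert key using 1
      rw [ih'.2, Gamma_add_one s hs, Gamma_add_one β hβ0]
      simp only [add_sub_add_right_eq_sub, smul_eq_mul]
      field_simp
    · refine Asymptotics.IsBigO.of_bound C ?_
      filter_upwards [self_mem_nhdsWithin] with u hu
      have hu : 0 < u := hu
      have := hC u hu.le
      rw [← Real.rpow_natCast, Nat.cast_succ] at this
      rwa [Real.norm_of_nonneg (by positivity)]
    · refine Asymptotics.IsBigO.of_bound D ?_
      filter_upwards [eventually_gt_atTop 0] with u hu
      have := hD u hu.le
      rw [← Real.rpow_natCast] at this
      rwa [Real.norm_of_nonneg (by positivity)]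

/-! ### Gegenbauer polynomials at the point `1` -/

/-- The coefficient of `(2 * (ξ - 1)) ^ n` in `G_j^λ(ξ)`. -/
noncomputable def gegenbauerCoeff (lam : ℂ) (j n : ℕ) : ℂ :=
  if n ≤ j then risingCoeff lam n * risingCoeff (2 * lam + 2 * n) (j - n) else 0

lemma gegenbauerCoeff_add (lam : ℂ) (n m : ℕ) :
    gegenbauerCoeff lam (n + m) n = risingCoeff lam n * risingCoeff (2 * lam + 2 * n) m := by
  simp [gegenbauerCoeff]

lemma gegenbauerCoeff_of_lt (lam : ℂ) {j n : ℕ} (h : j < n) : gegenbauerCoeff lam j n = 0 :=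
  if_neg (by omega)

lemma risingCoeff_one (a : ℂ) : risingCoeff a 1 = a := by
  simp [risingCoeff]

/-- The constant term, in powers of `2 * (ξ - 1)`, of the Gegenbauer recurrence. -/
lemma gegenbauerCoeff_recurrence_zero (lam : ℂ) (j : ℕ) :
    ((j : ℂ) + 2) * gegenbauerCoeff lam (j + 2) 0
      = 2 * (j + 1 + lam) * gegenbauerCoeff lam (j + 1) 0
        - (j + 2 * lam) * gegenbauerCoeff lam j 0 := by
  have h1 := succ_mul_risingCoeff_succ (2 * lam) j
  have h2 := succ_mul_risingCoeff_succ (2 * lam) (j + 1)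
  simp only [gegenbauerCoeff, zero_le, if_true, risingCoeff_zero, Nat.sub_zero, Nat.cast_zero,
    mul_zero, add_zero, one_mul]
  push_cast at h2
  linear_combination h2 - h1

/-- The coefficient of `(2 * (ξ - 1)) ^ (n + 1)` in the Gegenbauer recurrence, in which the factor
`2 * ξ` is written as `2 + 2 * (ξ - 1)`. -/
lemma gegenbauerCoeff_recurrence_succ (lam : ℂ) (j n : ℕ) :
    ((j : ℂ) + 2) * gegenbauerCoeff lam (j + 2) (n + 1)
      = 2 * (j + 1 + lam) * gegenbauerCoeff lam (j + 1) (n + 1)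
        + (j + 1 + lam) * gegenbauerCoeff lam (j + 1) n
        - (j + 2 * lam) * gegenbauerCoeff lam j (n + 1) := by
  have hR := succ_mul_risingCoeff_succ lam n
  rcases lt_trichotomy j n with h | rfl | h
  · rcases Nat.lt_or_ge (j + 1) n with h' | h'
    · simp [gegenbauerCoeff_of_lt lam (show j + 2 < n + 1 by omega),
        gegenbauerCoeff_of_lt lam (show j + 1 < n + 1 by omega),
        gegenbauerCoeff_of_lt lam (show j + 1 < n by omega),
        gegenbauerCoeff_of_lt lam (show j < n + 1 by omega)]
    · obtain rfl : n = j + 1 := by omega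
      have e1 := gegenbauerCoeff_add lam (j + 1 + 1) 0
      have e2 := gegenbauerCoeff_add lam (j + 1) 0
      simp only [add_zero, risingCoeff_zero, mul_one] at e1 e2
      rw [e1, e2, gegenbauerCoeff_of_lt lam (show j + 1 < j + 1 + 1 by omega),
        gegenbauerCoeff_of_lt lam (show j < j + 1 + 1 by omega)]
      push_cast at hR
      linear_combination hR
  · have e1 := gegenbauerCoeff_add lam (j + 1) 1
    have e2 := gegenbauerCoeff_add lam (j + 1) 0
    have e3 := gegenbauerCoeff_add lam j 1
    simp only [add_zero, risingCoeff_zero, mul_one, risingCoeff_one] at e1 e2 e3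
    rw [e1, e2, e3, gegenbauerCoeff_of_lt lam (show j < j + 1 by omega)]
    push_cast
    linear_combination (2 * (j + 1 + lam)) * hR
  · obtain ⟨m, rfl⟩ := Nat.exists_eq_add_of_lt h
    have e1 := gegenbauerCoeff_add lam (n + 1) (m + 2)
    have e2 := gegenbauerCoeff_add lam (n + 1) (m + 1)
    have e3 := gegenbauerCoeff_add lam n (m + 2)
    have e4 := gegenbauerCoeff_add lam (n + 1) m
    have f1 := succ_mul_risingCoeff_succ (2 * lam + 2 * (n + 1)) m
    have f2 := succ_mul_risingCoeff_succ (2 * lam + 2 * (n + 1)) (m + 1)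
    have f3 := succ_mul_risingCoeff_succ' (2 * lam + 2 * n) (m + 1)
    have f4 := succ_mul_risingCoeff_succ' (2 * lam + 2 * n + 1) m
    rw [show n + 1 + (m + 2) = n + m + 1 + 2 by ring] at e1
    rw [show n + 1 + (m + 1) = n + m + 1 + 1 by ring] at e2
    rw [show n + (m + 2) = n + m + 1 + 1 by ring] at e3
    rw [show n + 1 + m = n + m + 1 by ring] at e4
    rw [show 2 * lam + 2 * (n : ℂ) + 1 + 1 = 2 * lam + 2 * (n + 1) by ring] at f4
    rw [e1, e2, e3, e4]
    have hm1 : (m : ℂ) + 1 ≠ 0 := Nat.cast_add_one_ne_zero m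
    have hm2 : (m : ℂ) + 2 ≠ 0 := by
      have := Nat.cast_add_one_ne_zero (R := ℂ) (m + 1)
      push_cast at this
      rwa [add_assoc, one_add_one_eq_two] at this
    push_cast at *
    rw [show (m : ℂ) + 1 + 1 = m + 2 by ring] at f2 f3
    generalize risingCoeff (2 * lam + 2 * (n + 1)) m = p at *
    generalize risingCoeff (2 * lam + 2 * (n + 1)) (m + 1) = p1 at *
    generalize risingCoeff (2 * lam + 2 * (n + 1)) (m + 2) = p2 at *
    generalize risingCoeff (2 * lam + 2 * n + 1) (m + 1) = w1 at *
    generalize risingCoeff (2 * lam + 2 * n) (m + 2) = w2 at *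
    generalize risingCoeff lam (n + 1) = R1 at *
    generalize risingCoeff lam n = R at *
    obtain rfl : p1 = (2 * lam + 2 * (n + 1) + m) * p / (m + 1) := by
      field_simp; linear_combination f1
    obtain rfl : p2 = (2 * lam + 2 * (n + 1) + (m + 1))
        * ((2 * lam + 2 * (n + 1) + m) * p / (m + 1)) / (m + 2) := by
      rw [eq_div_iff hm2]; linear_combination f2
    obtain rfl : w1 = (2 * lam + 2 * n + 1) * p / (m + 1) := by
      field_simp; linear_combination f4
    obtain rfl : w2 = (2 * lam + 2 * n) * ((2 * lam + 2 * n + 1) * p / (m + 1)) / (m + 2) := by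
      rw [eq_div_iff hm2]; linear_combination f3
    -- Only `R1 = (lam + n) / (n + 1) * R` is left to use; the rest is a polynomial identity.
    field_simp
    linear_combination (2 * (n + m + 1 + 1 + lam) * (2 * lam + 2 * n + 1) * p) * hR

/-- The expansion of the Gegenbauer polynomials at the point `1`. -/
lemma eval_gegenbauer_eq_sum (lam : ℂ) (j : ℕ) (z : ℂ) :
    (gegenbauer lam j).eval z
      = ∑ n ∈ Finset.range (j + 1), gegenbauerCoeff lam j n * (2 * (z - 1)) ^ n := by
  induction j using Nat.strong_induction_on with
  | _ j ih =>
    match j with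
    | 0 => simp [gegenbauer, gegenbauerCoeff]
    | 1 =>
      simp [gegenbauer, gegenbauerCoeff, Finset.sum_range_succ, risingCoeff_one]
      ring
    | j + 2 =>
      have hj : (j : ℂ) + 2 ≠ 0 := by
        have := Nat.cast_add_one_ne_zero (R := ℂ) (j + 1)
        push_cast at this
        rwa [add_assoc, one_add_one_eq_two] at this
      have e0 : (gegenbauer lam j).eval z
          = ∑ n ∈ Finset.range (j + 3), gegenbauerCoeff lam j n * (2 * (z - 1)) ^ n := by
        rw [ih j (by omega), Finset.sum_range_succ _ (j + 2), Finset.sum_range_succ _ (j + 1),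
          gegenbauerCoeff_of_lt lam (show j < j + 1 by omega),
          gegenbauerCoeff_of_lt lam (show j < j + 2 by omega)]
        ring
      have e1 := ih (j + 1) (by omega)
      have e2 : (gegenbauer lam (j + 1)).eval z
          = ∑ n ∈ Finset.range (j + 3), gegenbauerCoeff lam (j + 1) n * (2 * (z - 1)) ^ n := by
        rw [e1, Finset.sum_range_succ _ (j + 2),
          gegenbauerCoeff_of_lt lam (show j + 1 < j + 2 by omega)]
        ring
      have key : ((j : ℂ) + 2) * (∑ n ∈ Finset.range (j + 3),
          gegenbauerCoeff lam (j + 2) n * (2 * (z - 1)) ^ n)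
          = 2 * (j + 1 + lam) * (gegenbauer lam (j + 1)).eval z
            + (j + 1 + lam) * ((2 * (z - 1)) * (gegenbauer lam (j + 1)).eval z)
            - (j + 2 * lam) * (gegenbauer lam j).eval z := by
        nth_rewrite 2 [e1]
        rw [e0, e2]
        simp only [Finset.sum_range_succ' _ (j + 2), mul_add, Finset.mul_sum]
        have h0 := gegenbauerCoeff_recurrence_zero lam j
        have hs : ∑ n ∈ Finset.range (j + 2),
              ((j : ℂ) + 2) * (gegenbauerCoeff lam (j + 2) (n + 1) * (2 * (z - 1)) ^ (n + 1))
            = ∑ n ∈ Finset.range (j + 2), 2 * (j + 1 + lam)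
                * (gegenbauerCoeff lam (j + 1) (n + 1) * (2 * (z - 1)) ^ (n + 1))
              + ∑ n ∈ Finset.range (j + 2), (j + 1 + lam)
                * (2 * (z - 1) * (gegenbauerCoeff lam (j + 1) n * (2 * (z - 1)) ^ n))
              - ∑ n ∈ Finset.range (j + 2), (j + 2 * lam)
                * (gegenbauerCoeff lam j (n + 1) * (2 * (z - 1)) ^ (n + 1)) := by
          rw [← Finset.sum_add_distrib, ← Finset.sum_sub_distrib]
          refine Finset.sum_congr rfl fun n _ ↦ ?_
          linear_combination (2 * (z - 1)) ^ (n + 1) * gegenbauerCoeff_recurrence_succ lam j n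
        simp only [mul_add] at hs
        rw [hs]
        linear_combination h0
      rw [gegenbauer]
      simp only [Polynomial.eval_mul, Polynomial.eval_C, Polynomial.eval_sub, Polynomial.eval_X]
      rw [inv_mul_eq_iff_eq_mul₀ hj]
      linear_combination -key

/-! ### Euler's transformation of the hypergeometric function -/

/-- The coefficient of `z ^ n` in the regularized hypergeometric series `₂F₁(a, b; c; z) / Γ(c)`. -/
noncomputable def gaussCoeff (a b c : ℂ) (n : ℕ) : ℂ :=
  (ascPochhammer ℂ n).eval a * (ascPochhammer ℂ n).eval b / (n ! * Gamma (c + n))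

lemma regularizedGaussHGFunSeries_apply (a b c z : ℂ) (n : ℕ) :
    (regularizedGaussHGFunSeries a b c n fun _ ↦ z) = gaussCoeff a b c n * z ^ n := by
  rw [FormalMultilinearSeries.apply_eq_pow_smul_coeff, coeff_regularizedGaussHGFunSeries,
    smul_eq_mul, mul_comm, gaussCoeff]

lemma summable_norm_gaussCoeff_mul_pow (a b c : ℂ) {z : ℂ} (hz : ‖z‖ < 1) :
    Summable fun n ↦ ‖gaussCoeff a b c n * z ^ n‖ := by
  have h := FormalMultilinearSeries.summable_norm_apply
    (regularizedGaussHGFunSeries a b c) (x := z)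
    (Metric.eball_subset_eball (radius_regularizedGaussHGFunSeries_ge_one a b c)
      (by simpa [enorm_eq_nnnorm] using! hz))
  simpa only [regularizedGaussHGFunSeries_apply] using h

lemma hasSum_gaussCoeff_mul_pow (a b c : ℂ) {z : ℂ} (hz : ‖z‖ < 1) :
    HasSum (fun n ↦ gaussCoeff a b c n * z ^ n) (regularizedGaussHGFun a b c z) := by
  have := (summable_norm_gaussCoeff_mul_pow a b c hz).of_norm.hasSum
  simpa only [regularizedGaussHGFun, FormalMultilinearSeries.sum,
    regularizedGaussHGFunSeries_apply] using this

lemma gaussCoeff_succ (a b : ℂ) {c : ℂ} (n : ℕ) (hc : c + n ≠ 0) :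
    ((n : ℂ) + 1) * (n + c) * gaussCoeff a b c (n + 1)
      = (n + a) * (n + b) * gaussCoeff a b c n := by
  have h1 : ((n : ℂ) + 1) ≠ 0 := Nat.cast_add_one_ne_zero n
  have h2 : ((n ! : ℕ) : ℂ) ≠ 0 := Nat.cast_ne_zero.mpr n.factorial_ne_zero
  have h3 : c + ((n + 1 : ℕ) : ℂ) = c + n + 1 := by push_cast; ring
  simp only [gaussCoeff, ascPochhammer_succ_eval, Nat.factorial_succ, h3, Gamma_add_one _ hc]
  push_cast
  by_cases hG : Gamma (c + n) = 0
  · simp [hG]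
  field_simp
  ring

open PowerSeries in
/-- The hypergeometric differential operator `X(1-X)F'' + (c-(a+b+1)X)F' - abF` acting on formal
power series. -/
noncomputable def hypergeometricOp (a b c : ℂ) (F : PowerSeries ℂ) : PowerSeries ℂ :=
  X * (1 - X) * d⁄dX ℂ (d⁄dX ℂ F) + (C c - (C a + C b + 1) * X) * d⁄dX ℂ F - C a * C b * F

open PowerSeries in
lemma coeff_X_mul_derivative (F : PowerSeries ℂ) (n : ℕ) :
    coeff n (X * d⁄dX ℂ F) = n * coeff n F := by
  cases n with
  | zero => simp
  | succ n => rw [coeff_succ_X_mul, coeff_derivative]; push_cast; ring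

open PowerSeries in
lemma coeff_hypergeometricOp (a b c : ℂ) (F : PowerSeries ℂ) (n : ℕ) :
    coeff n (hypergeometricOp a b c F)
      = (n + 1) * (n + c) * coeff (n + 1) F - (n + a) * (n + b) * coeff n F := by
  have hX : ∀ G : PowerSeries ℂ, X * d⁄dX ℂ (X * d⁄dX ℂ G)
      = X * X * d⁄dX ℂ (d⁄dX ℂ G) + X * d⁄dX ℂ G := by
    intro G
    rw [Derivation.leibniz]
    simp only [smul_eq_mul, derivative_X]
    ring
  have e : hypergeometricOp a b c F = X * d⁄dX ℂ (d⁄dX ℂ F) + C c * d⁄dX ℂ F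
      - (X * d⁄dX ℂ (X * d⁄dX ℂ F) + C (a + b) * (X * d⁄dX ℂ F) + C (a * b) * F) := by
    rw [hX, map_add, map_mul, hypergeometricOp]
    ring
  rw [e]
  simp only [LinearMap.map_sub, LinearMap.map_add, coeff_C_mul, coeff_X_mul_derivative, coeff_derivative]
  ring

open PowerSeries in
lemma hypergeometricOp_mk_gaussCoeff (a b : ℂ) {c : ℂ} (hc : ∀ n : ℕ, c + n ≠ 0) :
    hypergeometricOp a b c (mk (gaussCoeff a b c)) = 0 := by
  ext n
  rw [coeff_hypergeometricOp, coeff_mk, coeff_mk, gaussCoeff_succ a b n (hc n)]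
  simp

open PowerSeries in
lemma one_sub_X_mul_derivative_mk_risingCoeff (k : ℂ) :
    (1 - X) * d⁄dX ℂ (mk (risingCoeff k)) = C k * mk (risingCoeff k) := by
  ext n
  rw [sub_mul, one_mul, map_sub, coeff_X_mul_derivative, coeff_derivative, coeff_C_mul, coeff_mk,
    coeff_mk]
  linear_combination succ_mul_risingCoeff_succ k n

open PowerSeries in
/-- Euler's transformation for formal power series. Multiplication by `(1 - X) ^ (c - a - b)`
carries solutions of the hypergeometric equation with parameters `c - a, c - b, c` to solutions of
the one with parameters `a, b, c`. -/
lemma mk_gaussCoeff_eq_mul (a b : ℂ) {c : ℂ} (hc : ∀ n : ℕ, c + n ≠ 0) :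
    mk (gaussCoeff a b c) = mk (risingCoeff (a + b - c)) * mk (gaussCoeff (c - a) (c - b) c) := by
  set W := mk (risingCoeff (a + b - c)) with hW
  set Y := mk (gaussCoeff (c - a) (c - b) c) with hY
  have hW1 : (1 - X) * d⁄dX ℂ W = (C a + C b - C c) * W := by
    have := one_sub_X_mul_derivative_mk_risingCoeff (a + b - c)
    rwa [map_sub, map_add] at this
  have hW2 : (1 - X) * d⁄dX ℂ (d⁄dX ℂ W) = (C a + C b - C c + 1) * d⁄dX ℂ W := by
    have := congrArg (d⁄dX ℂ) hW1
    simp only [Derivation.leibniz, map_sub, map_add, derivative_X, derivative_C, smul_eq_mul,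
      Derivation.map_one_eq_zero] at this
    linear_combination this
  have hY1 := hypergeometricOp_mk_gaussCoeff (c - a) (c - b) hc
  rw [← hY, hypergeometricOp] at hY1
  simp only [map_sub] at hY1
  -- Multiplying by `1 - X` clears the denominator of `W' = (a + b - c) / (1 - X) * W`.
  have hop : hypergeometricOp a b c (W * Y) = 0 := by
    have h1 : (1 - X : PowerSeries ℂ) ≠ 0 := by
      intro h
      have := congrArg (coeff 0) h
      simp at this
    refine (mul_eq_zero.mp ?_).resolve_left h1
    rw [hypergeometricOp]
    simp only [Derivation.leibniz, map_add, smul_eq_mul]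
    linear_combination ((1 - X) * W) * hY1 + (X * (1 - X) * Y) * hW2
      + (X * (C a + C b - C c + 1) * Y + (C c - (C a + C b + 1) * X) * Y
        + 2 * X * (1 - X) * d⁄dX ℂ Y) * hW1
  ext n
  rw [coeff_mk]
  induction n with
  | zero => simp [hW, hY, gaussCoeff, PowerSeries.coeff_mul]
  | succ n ih =>
    have h := congrArg (coeff n) hop
    rw [coeff_hypergeometricOp, map_zero, ← ih, ← gaussCoeff_succ a b n (hc n), ← mul_sub] at h
    have h1 : ((n : ℂ) + 1) * (n + c) ≠ 0 :=
      mul_ne_zero (Nat.cast_add_one_ne_zero n) (by rw [add_comm]; exact hc n)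
    exact (sub_eq_zero.mp ((mul_eq_zero.mp h).resolve_left h1)).symm

/-- Euler's transformation of the Gauss hypergeometric function. -/
lemma regularizedGaussHGFun_eq_cpow_mul (a b : ℂ) {c z : ℂ} (hc : ∀ n : ℕ, c + n ≠ 0)
    (hz : ‖z‖ < 1) :
    regularizedGaussHGFun a b c z
      = (1 - z) ^ (c - a - b) * regularizedGaussHGFun (c - a) (c - b) c z := by
  have hW := hasSum_risingCoeff_mul_pow (a + b - c) hz
  have hY := hasSum_gaussCoeff_mul_pow (c - a) (c - b) c hz
  rw [show -(a + b - c) = c - a - b by ring] at hW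
  rw [← hW.tsum_eq, ← hY.tsum_eq, ← (hasSum_gaussCoeff_mul_pow a b c hz).tsum_eq,
    tsum_mul_tsum_eq_tsum_sum_antidiagonal_of_summable_norm
      (summable_norm_risingCoeff_mul_pow _ hz) (summable_norm_gaussCoeff_mul_pow _ _ _ hz)]
  congr 1
  ext n
  have h := congrArg (PowerSeries.coeff n) (mk_gaussCoeff_eq_mul a b hc)
  rw [PowerSeries.coeff_mul, PowerSeries.coeff_mk] at h
  rw [h, Finset.sum_mul]
  refine Finset.sum_congr rfl fun p hp ↦ ?_
  rw [PowerSeries.coeff_mk, PowerSeries.coeff_mk, ← Finset.HasAntidiagonal.mem_antidiagonal.mp hp, pow_add]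
  ring

/-! ### Termwise Mellin transformation -/

lemma integrable_of_hasSum_of_summable_integral_norm {α : Type*} [MeasurableSpace α]
    {μ : Measure α} {F : ℕ → α → ℂ} {f : α → ℂ} (hF : ∀ n, Integrable (F n) μ)
    (hsum : Summable fun n ↦ ∫ a, ‖F n a‖ ∂μ) (hf : ∀ᵐ a ∂μ, HasSum (fun n ↦ F n a) (f a)) :
    Integrable f μ := by
  refine ⟨?_, ?_⟩
  · refine aestronglyMeasurable_of_tendsto_ae (u := atTop)
      (f := fun N a ↦ ∑ n ∈ Finset.range N, F n a) ?_ ?_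
    · intro N
      exact (integrable_finsetSum _ fun n _ ↦ hF n).1
    · filter_upwards [hf] with a ha using ha.tendsto_sum_nat
  · rw [hasFiniteIntegral_iff_enorm]
    calc ∫⁻ a, ‖f a‖ₑ ∂μ ≤ ∫⁻ a, ∑' n, ‖F n a‖ₑ ∂μ := by
          refine lintegral_mono_ae ?_
          filter_upwards [hf] with a ha
          rw [← ha.tsum_eq]
          exact enorm_tsum_le_tsum_enorm
      _ = ∑' n, ∫⁻ a, ‖F n a‖ₑ ∂μ := lintegral_tsum fun n ↦ (hF n).1.enorm
      _ = ∑' n, ENNReal.ofReal (∫ a, ‖F n a‖ ∂μ) := by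
          congr 1; ext n; rw [ofReal_integral_norm_eq_lintegral_enorm (hF n)]
      _ < ⊤ := hsum.tsum_ofReal_lt_top

/-- Termwise Mellin transformation of a series. -/
lemma hasMellin_of_hasSum {F : ℕ → ℝ → ℂ} {f : ℝ → ℂ} {s A : ℂ} {a : ℕ → ℂ}
    (hF : ∀ n, HasMellin (F n) s (a n))
    (hsum : Summable fun n ↦ ∫ t in Ioi (0 : ℝ), ‖(t : ℂ) ^ (s - 1) • F n t‖)
    (hf : ∀ t, 0 < t → HasSum (fun n ↦ F n t) (f t)) (hA : HasSum a A) :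
    HasMellin f s A := by
  have hae : ∀ᵐ t : ℝ ∂(volume.restrict (Ioi (0 : ℝ))),
      HasSum (fun n ↦ (t : ℂ) ^ (s - 1) • F n t) ((t : ℂ) ^ (s - 1) • f t) := by
    filter_upwards [ae_restrict_mem measurableSet_Ioi] with t ht
    exact (hf t ht).const_smul ((t : ℂ) ^ (s - 1))
  refine ⟨integrable_of_hasSum_of_summable_integral_norm (fun n ↦ (hF n).1) hsum hae, ?_⟩
  have h := hasSum_integral_of_summable_integral_norm (fun n ↦ (hF n).1) hsum
  have e : (fun n ↦ ∫ t in Ioi (0 : ℝ), (t : ℂ) ^ (s - 1) • F n t) = a :=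
    funext fun n ↦ (hF n).2
  rw [e] at h
  rw [hA.unique h, mellin]
  refine integral_congr_ae ?_
  filter_upwards [hae] with t ht using ht.tsum_eq.symm

/-! ### The modified kernel as a series of Taylor remainders -/

lemma one_add_two_mul_add_sq_pos {ξ : ℝ} (hξ : -1 < ξ) (hξ' : ξ < 1) (u : ℝ) :
    0 < 1 + 2 * u * ξ + u ^ 2 := by
  nlinarith [sq_nonneg (u + ξ)]

lemma four_mul_div_one_add_sq_le_one {u : ℝ} (hu : 0 < u) : 4 * u / (1 + u) ^ 2 ≤ 1 := by
  rw [div_le_one (by positivity)]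
  nlinarith [sq_nonneg (1 - u)]

/-- The expansion of the kernel in the functions `u ^ n (1 + u) ^ (-2λ - 2n)`: since
`1 + 2uξ + u² = (1 + u)² (1 - w)` with `w = 2(1 - ξ)u / (1 + u)²`, this is the binomial series
in `w`. -/
lemma hasSum_rieszKernel (lam : ℂ) {ξ u : ℝ} (hξ : -1 < ξ) (hξ' : ξ < 1) (hu : 0 < u) :
    HasSum (fun n : ℕ ↦ risingCoeff lam n * (2 * (1 - ξ) : ℂ) ^ n
      * ((u : ℂ) ^ n * (1 + (u : ℂ)) ^ (-(2 * lam + 2 * n)))) (rieszKernel lam ξ u) := by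
  have hpos := one_add_two_mul_add_sq_pos hξ hξ' u
  have h1 : 0 < 1 + u := by linarith
  have hne : ((1 + u : ℝ) : ℂ) ≠ 0 := ofReal_ne_zero.mpr h1.ne'
  set w : ℝ := 2 * (1 - ξ) * u / (1 + u) ^ 2 with hw
  have hw1 : (1 - w) * ((1 + u) * (1 + u)) = 1 + 2 * u * ξ + u ^ 2 := by
    rw [hw]; field_simp; ring
  have hw2 : 0 < 1 - w := by
    by_contra hcon
    have : (1 - w) * ((1 + u) * (1 + u)) ≤ 0 :=
      mul_nonpos_of_nonpos_of_nonneg (not_lt.mp hcon) (by positivity)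
    linarith
  have hw0 : 0 ≤ w := by
    have : 0 < 1 - ξ := by linarith
    positivity
  have hnorm : ‖(w : ℂ)‖ < 1 := by
    rw [norm_real, Real.norm_of_nonneg hw0]; linarith
  have h := (hasSum_risingCoeff_mul_pow lam hnorm).mul_right (((1 + u : ℝ) : ℂ) ^ (-(2 * lam)))
  have e : (1 + (u : ℂ)) = ((1 + u : ℝ) : ℂ) := by push_cast; rfl
  convert! h using 1
  · ext n
    have e2 : ((1 + u : ℝ) : ℂ) ^ (-(2 * lam + 2 * n))
        = ((1 + u : ℝ) : ℂ) ^ (-(2 * lam)) * ((((1 + u : ℝ) : ℂ) ^ 2) ^ n)⁻¹ := by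
      rw [neg_add, cpow_add _ _ hne, cpow_neg _ (2 * (n : ℂ)), ← pow_mul, ← cpow_natCast _ (2 * n),
        Nat.cast_mul, Nat.cast_ofNat]
    have e3 : (w : ℂ) = (2 * (1 - ξ) : ℂ) * u / ((1 + u : ℝ) : ℂ) ^ 2 := by
      rw [hw]; push_cast; rfl
    rw [e, e2, e3, div_pow, mul_pow _ (u : ℂ) n]
    ring
  · rw [rieszKernel, ← hw1, ofReal_mul, mul_cpow_ofReal_nonneg hw2.le (by positivity),
      ofReal_mul, mul_cpow_ofReal_nonneg h1.le h1.le, ← cpow_add _ _ hne]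
    push_cast
    ring_nf

/-- The subtracted Taylor polynomial, expanded along the same functions as the kernel. -/
lemma sum_gegenbauer_eq (lam : ℂ) (q : ℕ) (ξ u : ℝ) :
    ∑ j ∈ Finset.range (q + 1), (-(u : ℂ)) ^ j * (gegenbauer lam j).eval (ξ : ℂ)
      = ∑ n ∈ Finset.range (q + 1), risingCoeff lam n * (2 * (1 - ξ) : ℂ) ^ n
        * ((u : ℂ) ^ n * ∑ m ∈ Finset.range (q + 1 - n),
            risingCoeff (2 * lam + 2 * n) m * (-(u : ℂ)) ^ m) := by
  simp_rw [eval_gegenbauer_eq_sum, Finset.mul_sum]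
  rw [Finset.sum_comm' (t' := Finset.range (q + 1)) (s' := fun n ↦ Finset.Ico n (q + 1))]
  · refine Finset.sum_congr rfl fun n hn ↦ ?_
    rw [Finset.sum_Ico_eq_sum_range]
    refine Finset.sum_congr rfl fun m _ ↦ ?_
    rw [gegenbauerCoeff_add, pow_add]
    have : (-(u : ℂ)) ^ n * (2 * ((ξ : ℂ) - 1)) ^ n = (2 * (1 - ξ) : ℂ) ^ n * (u : ℂ) ^ n := by
      rw [← mul_pow, ← mul_pow]; ring
    linear_combination ((-(u : ℂ)) ^ m * risingCoeff lam n
      * risingCoeff (2 * lam + 2 * n) m) * this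
  · intro j n
    simp only [Finset.mem_range, Finset.mem_Ico]
    omega

lemma hasSum_neg_modifiedKernel (lam : ℂ) (q : ℕ) {ξ u : ℝ} (hξ : -1 < ξ) (hξ' : ξ < 1)
    (hu : 0 < u) :
    HasSum (fun n : ℕ ↦ risingCoeff lam n * (2 * (1 - ξ) : ℂ) ^ n
      * ((u : ℂ) ^ n * binomialRemainder (2 * lam + 2 * n) (q + 1 - n) u))
      (-modifiedKernel lam q ξ u) := by
  have h2 := hasSum_sum_of_ne_finset_zero (L := .unconditional ℕ) (s := Finset.range (q + 1))
    (f := fun n : ℕ ↦ risingCoeff lam n * (2 * (1 - ξ) : ℂ) ^ n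
        * ((u : ℂ) ^ n * ∑ m ∈ Finset.range (q + 1 - n),
            risingCoeff (2 * lam + 2 * n) m * (-(u : ℂ)) ^ m))
    (fun n hn ↦ by
      rw [Finset.mem_range, not_lt] at hn
      simp [Nat.sub_eq_zero_of_le hn])
  rw [← sum_gegenbauer_eq] at h2
  convert! (hasSum_rieszKernel lam hξ hξ' hu).sub h2 using 1
  · ext n; rw [binomialRemainder]; ring
  · rw [modifiedKernel]; ring

lemma hasMellin_pow_mul_binomialRemainder (q n : ℕ) {lam s : ℂ} (hlam : 0 < lam.re)
    (hs : -(q : ℝ) - 1 < s.re) (hs' : s.re < -(q : ℝ)) :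
    HasMellin (fun u : ℝ ↦ (u : ℂ) ^ n * binomialRemainder (2 * lam + 2 * n) (q + 1 - n) u) s
      (Gamma (s + n) * Gamma (2 * lam - s + n) / Gamma (2 * lam + 2 * n)) := by
  have hq : (0 : ℝ) ≤ q := Nat.cast_nonneg q
  have hn : (0 : ℝ) ≤ n := Nat.cast_nonneg n
  have key := hasMellin_binomialRemainder (q + 1 - n) (β := 2 * lam + 2 * n) (s := s + n)
    (by simp; positivity) ?_ (by simp; linarith) ?_
  · have e : 2 * lam + 2 * n - (s + n) = 2 * lam - s + n := by ring
    rw [e] at key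
    refine ⟨?_, ?_⟩
    · have := MellinConvergent.cpow_smul.mpr key.1
      simpa only [cpow_natCast, smul_eq_mul] using this
    · have := mellin_cpow_smul (binomialRemainder (2 * lam + 2 * n) (q + 1 - n)) s n
      simp only [cpow_natCast, smul_eq_mul] at this
      rw [this, key.2]
  · rcases le_or_gt (q + 1) n with h | h
    · have h' : ((q + 1 : ℕ) : ℝ) ≤ n := by exact_mod_cast h
      push_cast at h'
      rw [Nat.sub_eq_zero_of_le h]
      simp
      linarith
    · rw [Nat.cast_sub h.le]
      push_cast
      simp
      linarith
  · intro h
    rw [Nat.cast_sub (by omega)]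
    push_cast
    simp
    linarith

/-- Since `4u ≤ (1 + u)²`, the unmodified terms decrease geometrically, uniformly in `u`. -/
lemma norm_pow_mul_binomialRemainder_zero_le (lam : ℂ) {N n : ℕ} (h : N ≤ n) {u : ℝ}
    (hu : 0 < u) :
    4 ^ n * ‖(u : ℂ) ^ n * binomialRemainder (2 * lam + 2 * n) 0 u‖
      ≤ 4 ^ N * ‖(u : ℂ) ^ N * binomialRemainder (2 * lam + 2 * N) 0 u‖ := by
  have h1 : 0 < 1 + u := by linarith
  have key : ∀ k : ℕ, 4 ^ k * ‖(u : ℂ) ^ k * binomialRemainder (2 * lam + 2 * k) 0 u‖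
      = (4 * u / (1 + u) ^ 2) ^ k * (1 + u) ^ (-(2 * lam.re)) := by
    intro k
    have e : (1 + (u : ℂ)) = ((1 + u : ℝ) : ℂ) := by push_cast; rfl
    have e2 : (-(2 * lam + 2 * (k : ℂ))).re = -(2 * lam.re) - ((2 * k : ℕ) : ℝ) := by
      simp; ring
    rw [binomialRemainder, Finset.range_zero, Finset.sum_empty, sub_zero, norm_mul, norm_pow,
      norm_real, Real.norm_of_nonneg hu.le, e, norm_cpow_eq_rpow_re_of_pos h1, e2,
      Real.rpow_sub_natCast h1.ne', div_pow, mul_pow, ← pow_mul]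
    ring
  rw [key, key]
  gcongr ?_ * _
  exact pow_le_pow_of_le_one (by positivity) (four_mul_div_one_add_sq_le_one hu) h

/-- From `n = q + 1` on nothing is subtracted from the terms, and each is at most `|(λ)ₙ| xⁿ / n!` times
a fixed integrable function, with `x = (1 - ξ) / 2`. -/
lemma summable_integral_norm_modifiedKernel_terms (q : ℕ) {ξ : ℝ} (hξ : -1 < ξ) (hξ' : ξ < 1)
    {lam s : ℂ} (hlam : 0 < lam.re) (hs : -(q : ℝ) - 1 < s.re) (hs' : s.re < -(q : ℝ)) :
    Summable fun n : ℕ ↦ ∫ u in Ioi (0 : ℝ), ‖(u : ℂ) ^ (s - 1)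
      • (risingCoeff lam n * (2 * (1 - ξ) : ℂ) ^ n
        * ((u : ℂ) ^ n * binomialRemainder (2 * lam + 2 * n) (q + 1 - n) u))‖ := by
  set x : ℝ := (1 - ξ) / 2 with hx
  have hx0 : 0 ≤ x := by rw [hx]; linarith
  have hx1 : ‖(x : ℂ)‖ < 1 := by
    rw [norm_real, Real.norm_of_nonneg hx0, hx]; linarith
  set B : ℝ := ∫ u in Ioi (0 : ℝ), ‖(u : ℂ) ^ (s - 1)
    • ((u : ℂ) ^ (q + 1) * binomialRemainder (2 * lam + 2 * (q + 1 : ℕ)) 0 u)‖ with hB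
  have hN := (hasMellin_pow_mul_binomialRemainder q (q + 1) hlam hs hs').1
  rw [Nat.sub_self] at hN
  refine Summable.of_norm_bounded_eventually_nat
    (g := fun n ↦ ‖risingCoeff lam n * (x : ℂ) ^ n‖ * (4 ^ (q + 1) * B))
    ((summable_norm_risingCoeff_mul_pow lam hx1).mul_right _) ?_
  filter_upwards [eventually_ge_atTop (q + 1)] with n hn
  rw [Real.norm_of_nonneg (integral_nonneg fun _ ↦ norm_nonneg _), Nat.sub_eq_zero_of_le hn, hB,
    ← integral_const_mul, ← integral_const_mul]
  refine integral_mono_of_nonneg (ae_of_all _ fun _ ↦ norm_nonneg _)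
    ((hN.norm.const_mul _).const_mul _) ?_
  filter_upwards [ae_restrict_mem measurableSet_Ioi] with u hu
  have key := norm_pow_mul_binomialRemainder_zero_le lam hn hu
  have e : ‖(2 * (1 - ξ) : ℂ) ^ n‖ = ‖(x : ℂ) ^ n‖ * 4 ^ n := by
    have : (2 * (1 - ξ) : ℂ) = (x : ℂ) * 4 := by rw [hx]; push_cast; ring
    rw [this, mul_pow, norm_mul, norm_pow (4 : ℂ)]
    simp
  rw [smul_eq_mul, smul_eq_mul, norm_mul, norm_mul (_ * _), norm_mul (risingCoeff _ _), e,
    norm_mul (risingCoeff _ _), norm_mul ((u : ℂ) ^ (s - 1))]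
  calc _ = ‖(u : ℂ) ^ (s - 1)‖ * (‖risingCoeff lam n‖ * ‖(x : ℂ) ^ n‖)
          * (4 ^ n * ‖(u : ℂ) ^ n * binomialRemainder (2 * lam + 2 * n) 0 u‖) := by ring
    _ ≤ ‖(u : ℂ) ^ (s - 1)‖ * (‖risingCoeff lam n‖ * ‖(x : ℂ) ^ n‖)
          * (4 ^ (q + 1) * ‖(u : ℂ) ^ (q + 1)
            * binomialRemainder (2 * lam + 2 * (q + 1 : ℕ)) 0 u‖) := by gcongr
    _ = _ := by ring

/-! ### Evaluation of the series -/

lemma ascPochhammer_mul_Gamma {z : ℂ} (hz : ∀ k : ℕ, z ≠ -k) (n : ℕ) :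
    (ascPochhammer ℂ n).eval z * Gamma z = Gamma (z + n) := by
  rw [← Gamma_add_nat_div_Gamma_eq z hz, div_mul_cancel₀ _ (Gamma_ne_zero hz)]

lemma ne_neg_natCast_of_re_pos {z : ℂ} (hz : 0 < z.re) (k : ℕ) : z ≠ -k := by
  rintro rfl
  simp only [neg_re, natCast_re] at hz
  have : (0 : ℝ) ≤ k := Nat.cast_nonneg k
  linarith

/-- By Legendre's duplication formula for `Γ(2λ + 2n)`, the Mellin transforms of the terms are the
terms of a hypergeometric series. -/
lemma risingCoeff_mul_Gamma_mul_Gamma_div {lam s : ℂ} (hlam : 0 < lam.re)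
    (hs : ∀ k : ℕ, s ≠ -k) (hls : ∀ k : ℕ, 2 * lam - s ≠ -k) (ξ : ℝ) (n : ℕ) :
    risingCoeff lam n * (2 * (1 - ξ) : ℂ) ^ n
        * (Gamma (s + n) * Gamma (2 * lam - s + n) / Gamma (2 * lam + 2 * n))
      = (Real.sqrt Real.pi : ℂ) * 2 ^ (1 - 2 * lam) * Gamma s * Gamma (2 * lam - s) / Gamma lam
        * (gaussCoeff s (2 * lam - s) (lam + 1 / 2) n * (((1 - ξ) / 2 : ℝ) : ℂ) ^ n) := by
  have hn : (0 : ℝ) ≤ n := Nat.cast_nonneg n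
  have h1 : Gamma lam ≠ 0 := Gamma_ne_zero_of_re_pos hlam
  have h2 : Gamma (lam + 1 / 2 + n) ≠ 0 := Gamma_ne_zero_of_re_pos (by simp; linarith)
  have h3 : Gamma (2 * lam + 2 * n) ≠ 0 := Gamma_ne_zero_of_re_pos (by simp; linarith)
  have h4 : ((n ! : ℕ) : ℂ) ≠ 0 := Nat.cast_ne_zero.mpr n.factorial_ne_zero
  have hdup := Gamma_mul_Gamma_add_half (lam + n)
  rw [show lam + n + 1 / 2 = lam + 1 / 2 + n by ring,
    ← ascPochhammer_mul_Gamma (ne_neg_natCast_of_re_pos hlam) n,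
    show 2 * (lam + n) = 2 * lam + 2 * n by ring,
    show 1 - (2 * lam + 2 * n) = (1 - 2 * lam) + -((2 * n : ℕ) : ℂ) by push_cast; ring,
    cpow_add _ _ two_ne_zero, cpow_neg, cpow_natCast, pow_mul] at hdup
  have hx : (2 * (1 - ξ) : ℂ) = 2 ^ 2 * (((1 - ξ) / 2 : ℝ) : ℂ) := by push_cast; ring
  have h5 : ((2 : ℂ) ^ 2) ^ n ≠ 0 := pow_ne_zero _ (by norm_num)
  rw [hx, mul_pow, ← ascPochhammer_mul_Gamma hs n, ← ascPochhammer_mul_Gamma hls n, risingCoeff,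
    gaussCoeff]
  generalize ((2 : ℂ) ^ 2) ^ n = t at *
  generalize (((1 - ξ) / 2 : ℝ) : ℂ) ^ n = y at *
  generalize Gamma (2 * lam + 2 * n) = G1 at *
  generalize Gamma (lam + 1 / 2 + n) = G2 at *
  generalize 2 * lam - s = s' at *
  field_simp at hdup ⊢
  linear_combination (y * (ascPochhammer ℂ n).eval s * (ascPochhammer ℂ n).eval s'
    * Gamma s * Gamma s') * hdup

lemma cpow_mul_mul_cpow_div {p m : ℝ} (hp : 0 < p) (hm : 0 < m) (e : ℂ) :
    ((p * m : ℝ) : ℂ) ^ e * ((p / m : ℝ) : ℂ) ^ e = (p : ℂ) ^ (2 * e) := by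
  have hp' : (p : ℂ) ≠ 0 := ofReal_ne_zero.mpr hp.ne'
  have hmul : (p * m) * (p / m) = p * p := by field_simp
  rw [← mul_cpow_ofReal_nonneg (by positivity) (by positivity), ← ofReal_mul, hmul, ofReal_mul,
    mul_cpow_ofReal_nonneg hp.le hp.le, ← cpow_add _ _ hp', two_mul]

/-- Euler's transformation turns the hypergeometric series of the Mellin transform into the Legendre
function on the cut. -/
lemma two_cpow_mul_regularizedGaussHGFun_eq_legendreOnCut {lam : ℂ} (s : ℂ) (hlam : 0 < lam.re)
    {ξ : ℝ} (hξ : -1 < ξ) (hξ' : ξ < 1) :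
    (2 : ℂ) ^ (1 - 2 * lam)
        * regularizedGaussHGFun s (2 * lam - s) (lam + 1 / 2) (((1 - ξ) / 2 : ℝ) : ℂ)
      = ((2 : ℂ) ^ (lam - 1 / 2))⁻¹ * (((1 - ξ ^ 2 : ℝ) : ℂ) ^ ((1 - 2 * lam) / 4)
        * legendreOnCut (s - lam - 1 / 2) (1 / 2 - lam) ξ) := by
  have hp : 0 < 1 + ξ := by linarith
  have hm : 0 < 1 - ξ := by linarith
  have hc : ∀ n : ℕ, lam + 1 / 2 + n ≠ 0 := by
    intro n h
    have := congrArg re h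
    have hn : (0 : ℝ) ≤ n := Nat.cast_nonneg n
    simp at this
    linarith
  have hx1 : ‖(((1 - ξ) / 2 : ℝ) : ℂ)‖ < 1 := by
    rw [norm_real, Real.norm_of_nonneg (by linarith)]; linarith
  rw [regularizedGaussHGFun_eq_cpow_mul _ _ hc hx1, legendreOnCut,
    show lam + 1 / 2 - s - (2 * lam - s) = 1 / 2 - lam by ring,
    show -(s - lam - 1 / 2) = lam + 1 / 2 - s by ring,
    show s - lam - 1 / 2 + 1 = lam + 1 / 2 - (2 * lam - s) by ring,
    show 1 - (1 / 2 - lam) = lam + 1 / 2 by ring,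
    show (1 / 2 - lam) / 2 = (1 - 2 * lam) / 4 by ring,
    show 1 - ξ ^ 2 = (1 + ξ) * (1 - ξ) by ring]
  have hAB := cpow_mul_mul_cpow_div hp hm ((1 - 2 * lam) / 4)
  rw [show 2 * ((1 - 2 * lam) / 4) = 1 / 2 - lam by ring] at hAB
  have hpow : (2 : ℂ) ^ (1 - 2 * lam) * (1 - (((1 - ξ) / 2 : ℝ) : ℂ)) ^ (1 / 2 - lam)
      = ((2 : ℂ) ^ (lam - 1 / 2))⁻¹ * ((1 + ξ : ℝ) : ℂ) ^ (1 / 2 - lam) := by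
    have e1 : 1 - (((1 - ξ) / 2 : ℝ) : ℂ) = (((1 + ξ) / 2 : ℝ) : ℂ) := by push_cast; ring
    have e2 : 1 + ξ = 2 * ((1 + ξ) / 2) := by ring
    rw [e1]
    nth_rewrite 2 [e2]
    rw [ofReal_mul, mul_cpow_ofReal_nonneg zero_le_two (by linarith), ofReal_ofNat, ← cpow_neg,
      ← mul_assoc, ← cpow_add _ _ two_ne_zero]
    ring_nf
  rw [← mul_assoc, hpow, ← hAB]
  ring

theorem mainTheorem1 (q : ℕ) (ξ : ℝ) (hξ : -1 < ξ) (hξ' : ξ < 1) (lam s : ℂ)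
    (hlam : 0 < lam.re) (hs : -(q : ℝ) - 1 < s.re) (hs' : s.re < -(q : ℝ)) :
    HasMellin (modifiedKernel lam q ξ) s
      (-((Real.sqrt Real.pi : ℂ) * Complex.Gamma s * Complex.Gamma (2 * lam - s)
            / ((2 : ℂ) ^ (lam - 1 / 2) * Complex.Gamma lam))
        * ((1 - ξ ^ 2 : ℝ) : ℂ) ^ ((1 - 2 * lam) / 4)
        * legendreOnCut (s - lam - 1 / 2) (1 / 2 - lam) ξ) := by
  have hq : (0 : ℝ) ≤ q := Nat.cast_nonneg q
  -- `Re s` lies strictly between two consecutive integers, so `s` is not a pole of `Γ`.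
  have hsk : ∀ k : ℕ, s ≠ -k := by
    rintro k rfl
    simp only [neg_re, natCast_re] at hs hs'
    have h1 : (q : ℝ) < k := by linarith
    have h2 : (k : ℝ) < (q + 1 : ℕ) := by push_cast; linarith
    rw [Nat.cast_lt] at h1 h2
    omega
  have hlsk := ne_neg_natCast_of_re_pos (z := 2 * lam - s) (by simp; linarith)
  have hx1 : ‖(((1 - ξ) / 2 : ℝ) : ℂ)‖ < 1 := by
    rw [norm_real, Real.norm_of_nonneg (by linarith)]; linarith
  have hterm : ∀ n : ℕ, HasMellin (fun u : ℝ ↦ risingCoeff lam n * (2 * (1 - ξ) : ℂ) ^ n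
      * ((u : ℂ) ^ n * binomialRemainder (2 * lam + 2 * n) (q + 1 - n) u)) s
      (risingCoeff lam n * (2 * (1 - ξ) : ℂ) ^ n
        * (Gamma (s + n) * Gamma (2 * lam - s + n) / Gamma (2 * lam + 2 * n))) := by
    intro n
    have h := hasMellin_pow_mul_binomialRemainder q n hlam hs hs'
    have h' := hasMellin_const_smul h.1 (risingCoeff lam n * (2 * (1 - ξ) : ℂ) ^ n)
    rw [h.2] at h'
    exact h'
  have hsum := ((hasSum_gaussCoeff_mul_pow s (2 * lam - s) (lam + 1 / 2) hx1).mul_left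
    ((Real.sqrt Real.pi : ℂ) * 2 ^ (1 - 2 * lam) * Gamma s * Gamma (2 * lam - s) / Gamma lam))
  simp only [← risingCoeff_mul_Gamma_mul_Gamma_div hlam hsk hlsk ξ] at hsum
  have key := hasMellin_of_hasSum hterm
    (summable_integral_norm_modifiedKernel_terms q hξ hξ' hlam hs hs')
    (fun u hu ↦ hasSum_neg_modifiedKernel lam q hξ hξ' hu) hsum
  -- The series sums to the negative of the modified kernel.
  have hneg := hasMellin_const_smul key.1 (-1 : ℂ)
  rw [key.2] at hneg
  simp only [smul_eq_mul, neg_mul, one_mul, neg_neg] at hneg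
  convert hneg using 1
  have h := two_cpow_mul_regularizedGaussHGFun_eq_legendreOnCut s hlam hξ hξ'
  rw [neg_mul, neg_mul, neg_inj, div_mul_eq_div_div]
  linear_combination (-((Real.sqrt Real.pi : ℂ) * Gamma s * Gamma (2 * lam - s) / Gamma lam)) * h
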